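/- Let $G$ be a finite loopless multigraph (parallel edges are allowed), where the degree of a vertex is the number of edges incident to it (parallel edges counted separately) and $\Delta(G)$ denotes the maximum degree. The total graph $T(G)$ is the simple graph with vertex set the disjoint union $V(G) \cup E(G)$ in which two distinct vertices are adjacent if and only if the corresponding elements of $G$ are adjacent or incident in $G$ (two edges being adjacent when they share an endpoint). A finite graph $H$ is equitably $k$-choosable if, for every assignment $L$ of a list $L(v)$ of exactly $k$ colors to each vertex $v$ of $H$, there is a proper coloring $f$ of $H$ with $f(v) \in L(v)$ for all $v$ in which each color is used on at most $\lceil |V(H)|/k \rceil$ vertices. Let $\chi_l(H)$ denote the list chromatic number of $H$, i.e. the least $k$ such that $H$ has a proper coloring from the lists whenever every list has size at least $k$. If $\Delta(G) \leq 2$, then $T(G)$ is equitably $k$-choosable for every $k \geq \Delta(G)+2$. In particular, the List Equitable Total Coloring Conjecture holds for every finite simple graph $G$ with $\Delta(G) \leq 2$: for such $G$, $T(G)$ is equitably $k$-choosable for every $k \geq \max\{\chi_l(T(G)), \Delta(G)+2\}$. -/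

import Mathlib

namespace SimpleGraph

variable {W : Type*}

/-- `f` is a proper `L`-coloring of `H`, for a list assignment `L`. Colors are natural numbers;
for finite graphs this loses no generality, since only finitely many colors occur in the lists. -/
def IsProperListColoring (H : SimpleGraph W) (L : W → Finset ℕ) (f : W → ℕ) : Prop :=
  (∀ v, f v ∈ L v) ∧ ∀ v w, H.Adj v w → f v ≠ f w

/-- `L` is a `k`-assignment: every list has exactly `k` colors. -/
def IsAssignment (L : W → Finset ℕ) (k : ℕ) : Prop := ∀ v, (L v).card = k

/-- `f` is an equitable `L`-coloring for a `k`-assignment `L`: it is a proper `L`-coloring and each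
color appears on at most `⌈|V(H)| / k⌉` vertices. -/
def IsEquitableListColoring (H : SimpleGraph W) (L : W → Finset ℕ) (k : ℕ) (f : W → ℕ) : Prop :=
  H.IsProperListColoring L f ∧ ∀ c : ℕ, {v | f v = c}.ncard ≤ ⌈(Nat.card W : ℚ) / (k : ℚ)⌉₊

/-- `H` is equitably `k`-choosable: every `k`-assignment admits an equitable list coloring. -/
def EquitablyChoosable (H : SimpleGraph W) (k : ℕ) : Prop :=
  ∀ L : W → Finset ℕ, IsAssignment L k → ∃ f : W → ℕ, H.IsEquitableListColoring L k f

/-- The list chromatic number: the least `k` such that `H` has a proper `L`-coloring whenever all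
lists of `L` have size at least `k`. -/
noncomputable def listChromaticNumber (H : SimpleGraph W) : ℕ :=
  sInf {k | ∀ L : W → Finset ℕ, (∀ v, k ≤ (L v).card) → ∃ f : W → ℕ, H.IsProperListColoring L f}

end SimpleGraph

namespace Graph

variable {α β : Type*}

/-- The degree of a vertex in a loopless multigraph: the number of edges incident to it,
parallel edges being counted separately. -/
noncomputable def degree (G : Graph α β) (v : α) : ℕ := (G.incidenceSet v).ncard

/-- The maximum degree of a finite loopless multigraph (`0` if it has no vertices). -/
noncomputable def maxDegree (G : Graph α β) : ℕ := ⨆ v : G.vertexSet, G.degree v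

/-- Adjacency and incidence between the elements (vertices and edges) of a multigraph: two vertices
are adjacent if some edge joins them, two distinct edges are adjacent if they share an end, and
an edge is incident to its ends. -/
def TotalRel (G : Graph α β) : G.vertexSet ⊕ G.edgeSet → G.vertexSet ⊕ G.edgeSet → Prop
  | .inl u, .inl v => u ≠ v ∧ G.Adj u v
  | .inl u, .inr e => G.Inc e u
  | .inr e, .inl u => G.Inc e u
  | .inr e, .inr f => e ≠ f ∧ ∃ x, G.Inc e x ∧ G.Inc f x

/-- The total graph `T(G)`, with vertex set `V(G) ∪ E(G)` (a disjoint union). -/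
def totalGraph (G : Graph α β) : SimpleGraph (G.vertexSet ⊕ G.edgeSet) where
  Adj := G.TotalRel
  symm := ⟨by
    rintro (u | e) (v | f) h
    · exact ⟨h.1.symm, h.2.symm⟩
    · exact h
    · exact h
    · obtain ⟨hne, x, h1, h2⟩ := h
      exact ⟨hne.symm, x, h2, h1⟩⟩
  loopless := ⟨by
    rintro (u | e) h
    · exact h.1 rfl
    · exact h.1 rfl⟩

/-- The assertion of the List Equitable Total Coloring Conjecture for one graph `G`: the total
graph `T(G)` is equitably `k`-choosable for each `k ≥ max {χ_l(T(G)), Δ(G) + 2}`. -/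
def ListEquitableTotalColoring (G : Graph α β) : Prop :=
  ∀ k : ℕ, max G.totalGraph.listChromaticNumber (G.maxDegree + 2) ≤ k →
    G.totalGraph.EquitablyChoosable k

end Graph

/-!
A loopless multigraph with maximum degree at most two is a disjoint union of paths and cycles, so
its total graph is a disjoint union of squares of paths and squares of cycles of even length (the
cycle `v₀ e₁ v₁ … eₙ` of vertices and edges of `G`; two parallel edges give a cycle of length
four). The decomposition (`IncidenceList.exists_isDecomposition`) is found by inserting the edges
one at a time: the ends of a new edge have degree at most one before, hence are ends of paths, and
the edge joins two paths or closes one path to a cycle.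

*Small bandwidth.* If the vertices of `H` are listed so that adjacent ones are at distance at most
`k - 1` in the list, then greedy colouring makes any `k` consecutive vertices differently coloured.
This is proper, and cutting the list into blocks of `k` shows that every colour is used at most
`⌈|V(H)| / k⌉` times (`SimpleGraph.equitablyChoosable_of_withinDist`). For `Δ(G) ≤ 1` there are
only paths, and concatenating them suffices. For `k ≥ 5` each cycle is reordered as
`x₀, xₙ₋₁, x₁, xₙ₋₂, …` (`List.zigzag`), in which cyclic distance two becomes distance at most four.

*The case `k = 4`.* A cycle is cut into blocks of four positions, preceded by two extra positions
`0`, `1` when its length is `2` modulo `4`, and each block receives distinct colours. Before the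
last block is coloured its lists have at least `2, 3, 3, 2` colours left, so distinct
representatives fail to exist only if the two middle lists coincide and have three elements. Given
the colour of position `0`, this happens for at most one colour of the position just before the
last block (`exists_forbidden_color`), and the greedy colouring of the preceding block has enough
slack to avoid it; a cycle of length six, in which that position is `1`, needs a separate choice
(`exists_pair_card_union`). The two extra positions can moreover avoid any two given colours, so
two cycles of length `2` modulo `4` and total length `4q` together use every colour at most `q`
times, and when one such cycle is left over, the first two vertices of the concatenated paths complete its extra pair to
a block of four (`SimpleGraph.equitablyChoosable_four`).
-/

/-! ### Colouring sequences from lists -/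

/-- Greedy colouring: if the list at position `i` is larger than `min i (k - 1)`, colours can be
chosen so that any `k` consecutive positions receive distinct colours. -/
theorem exists_seq_window_ne (k : ℕ) (A : ℕ → Finset ℕ)
    (hA : ∀ i, min i (k - 1) < (A i).card) (n : ℕ) :
    ∃ c : ℕ → ℕ, (∀ i < n, c i ∈ A i) ∧ ∀ i j, i < j → j < i + k → j < n → c i ≠ c j := by
  induction n with
  | zero => exact ⟨fun _ => 0, by simp, by simp⟩
  | succ n ih =>
    obtain ⟨c, h1, h2⟩ := ih
    have hlt : ((Finset.Ico (n - (k - 1)) n).image c).card < (A n).card := by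
      refine lt_of_le_of_lt (Finset.card_image_le.trans ?_) (hA n)
      rw [Nat.card_Ico]; omega
    obtain ⟨x, hx, hx'⟩ := Finset.exists_mem_notMem_of_card_lt_card hlt
    refine ⟨Function.update c n x, fun i hi => ?_, fun i j hij hjk hj => ?_⟩
    · rcases Nat.lt_succ_iff_lt_or_eq.1 hi with h | rfl
      · rw [Function.update_of_ne h.ne]; exact h1 i h
      · simpa using hx
    · rw [Function.update_of_ne (by omega : i ≠ n)]
      rcases Nat.lt_succ_iff_lt_or_eq.1 hj with h | rfl
      · rw [Function.update_of_ne h.ne]; exact h2 i j hij hjk h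
      · rw [Function.update_self]
        rintro rfl
        exact hx' (Finset.mem_image.2 ⟨i, Finset.mem_Ico.2 ⟨by omega, hij⟩, rfl⟩)

/-- If `c` is injective on each block `{i | (i + o) / k = b}`, a colour occurs at most once per
block. -/
theorem card_color_le {k n o : ℕ} (hk : 0 < k) {c : ℕ → ℕ}
    (hc : ∀ i j, i < j → j < n → (i + o) / k = (j + o) / k → c i ≠ c j) (x : ℕ) :
    ((Finset.range n).filter (c · = x)).card ≤ (n + o + k - 1) / k := by
  rw [← Finset.card_range ((n + o + k - 1) / k)]
  refine Finset.card_le_card_of_injOn (fun i => (i + o) / k) ?_ ?_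
  · intro i hi
    simp only [Finset.coe_filter, Finset.mem_range, Set.mem_ofPred_eq, Finset.coe_range,
      Set.mem_Iio] at hi ⊢
    have : i + o + k ≤ n + o + k - 1 := by omega
    have := Nat.div_le_div_right (c := k) this
    rw [Nat.add_div_right _ hk] at this
    omega
  · intro i hi j hj hij
    simp only [Finset.coe_filter, Finset.mem_range, Set.mem_ofPred_eq] at hi hj hij
    rcases lt_trichotomy i j with h | h | h
    · exact absurd (hi.2.trans hj.2.symm) (hc i j h hj.1 hij)
    · exact h
    · exact absurd (hj.2.trans hi.2.symm) (hc j i h hi.1 hij.symm)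

/-- A colour that avoids the (possibly incomplete) initial block occurs one time fewer. -/
theorem card_color_lt {k n o : ℕ} (hk : 0 < k) (hn : 0 < n + o) {c : ℕ → ℕ}
    (hc : ∀ i j, i < j → j < n → (i + o) / k = (j + o) / k → c i ≠ c j) {x : ℕ}
    (hx : ∀ i < n, i + o < k → c i ≠ x) :
    ((Finset.range n).filter (c · = x)).card < (n + o + k - 1) / k := by
  have hpos : 0 < (n + o + k - 1) / k := Nat.div_pos (by omega) hk
  refine lt_of_le_of_lt (b := (Finset.Ico 1 ((n + o + k - 1) / k)).card) ?_
    (by rw [Nat.card_Ico]; omega)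
  refine Finset.card_le_card_of_injOn (fun i => (i + o) / k) ?_ ?_
  · intro i hi
    simp only [Finset.coe_filter, Finset.mem_range, Set.mem_ofPred_eq, Finset.coe_Ico,
      Set.mem_Ico] at hi ⊢
    have hle : i + o + k ≤ n + o + k - 1 := by omega
    have := Nat.div_le_div_right (c := k) hle
    rw [Nat.add_div_right _ hk] at this
    refine ⟨Nat.div_pos ?_ hk, by omega⟩
    by_contra hlt
    exact hx i hi.1 (by omega) hi.2
  · intro i hi j hj hij
    simp only [Finset.coe_filter, Finset.mem_range, Set.mem_ofPred_eq] at hi hj hij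
    rcases lt_trichotomy i j with h | h | h
    · exact absurd (hi.2.trans hj.2.symm) (hc i j h hj.1 hij)
    · exact h
    · exact absurd (hj.2.trans hi.2.symm) (hc j i h hi.1 hij.symm)

/-! ### Closing a cycle with lists of size four -/

theorem exists_mem_notMem_pair {A : Finset ℕ} (a b : ℕ) (hA : 3 ≤ A.card) :
    ∃ x ∈ A, x ≠ a ∧ x ≠ b := by
  have : ({a, b} : Finset ℕ).card < A.card := lt_of_le_of_lt Finset.card_le_two (by omega)
  obtain ⟨x, hx, hx'⟩ := Finset.exists_mem_notMem_of_card_lt_card this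
  exact ⟨x, hx, by simpa using hx'⟩

theorem exists_mem_notMem_triple {A : Finset ℕ} (a b d : ℕ) (hA : 4 ≤ A.card) :
    ∃ x ∈ A, x ≠ a ∧ x ≠ b ∧ x ≠ d := by
  have : ({a, b, d} : Finset ℕ).card < A.card := lt_of_le_of_lt Finset.card_le_three (by omega)
  obtain ⟨x, hx, hx'⟩ := Finset.exists_mem_notMem_of_card_lt_card this
  exact ⟨x, hx, by simpa using hx'⟩

/-- Distinct representatives for the last block of a cycle, whose lists have lost two, one, one and
two colours to the neighbours outside the block. By Hall's condition the only obstruction is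
that the two middle lists coincide and have three elements. -/
theorem exists_distinct_four {B₁ B₂ B₃ B₄ : Finset ℕ} (h₁ : 2 ≤ B₁.card) (h₂ : 3 ≤ B₂.card)
    (h₃ : 3 ≤ B₃.card) (h₄ : 2 ≤ B₄.card) (h : 4 ≤ (B₂ ∪ B₃).card) :
    ∃ x₁ ∈ B₁, ∃ x₂ ∈ B₂, ∃ x₃ ∈ B₃, ∃ x₄ ∈ B₄,
      x₁ ≠ x₂ ∧ x₁ ≠ x₃ ∧ x₁ ≠ x₄ ∧ x₂ ≠ x₃ ∧ x₂ ≠ x₄ ∧ x₃ ≠ x₄ := by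
  obtain ⟨x₁, hx₁⟩ := Finset.card_pos.1 (by omega : 0 < B₁.card)
  obtain ⟨x₄, hx₄, h41⟩ := Finset.exists_mem_ne (by omega : 1 < B₄.card) x₁
  obtain ⟨x₂, hx₂, h21, h24⟩ := exists_mem_notMem_pair x₁ x₄ h₂
  obtain ⟨x₃, hx₃, h31, h34⟩ := exists_mem_notMem_pair x₁ x₄ h₃
  by_cases h23 : x₂ = x₃
  · -- a fourth colour of the union replaces one of the two equal choices
    obtain ⟨y, hy, y1, y4, y2⟩ := exists_mem_notMem_triple x₁ x₄ x₂ h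
    rcases Finset.mem_union.1 hy with hy | hy
    · exact ⟨x₁, hx₁, y, hy, x₃, hx₃, x₄, hx₄, by grind⟩
    · exact ⟨x₁, hx₁, x₂, hx₂, y, hy, x₄, hx₄, by grind⟩
  · exact ⟨x₁, hx₁, x₂, hx₂, x₃, hx₃, x₄, hx₄, by grind⟩

/-- Only one value `f` of the colour next to the last block can obstruct its colouring. -/
theorem exists_forbidden_color {A B : Finset ℕ} (hA : A.card = 4) (hB : 3 ≤ B.card) :
    ∃ f, ∀ y ≠ f, 4 ≤ (A.erase y ∪ B).card := by
  rcases hB.lt_or_eq with h | h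
  · exact ⟨0, fun y _ => h.trans_le (Finset.card_le_card Finset.subset_union_right)⟩
  · obtain ⟨f, hf, hf'⟩ := Finset.exists_mem_notMem_of_card_lt_card (by omega : B.card < A.card)
    refine ⟨f, fun y hy => ?_⟩
    have : insert f B ⊆ A.erase y ∪ B := by
      intro z hz
      rcases Finset.mem_insert.1 hz with rfl | hz
      · simp [hf, hy.symm]
      · simp [hz]
    have := Finset.card_le_card this
    rw [Finset.card_insert_of_notMem hf'] at this
    omega

theorem mem_sdiff_of_card_erase_union_le {A B : Finset ℕ} (hA : A.card = 4) (hB : B.card = 4)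
    {r s : ℕ} (h : (A.erase s ∪ B.erase r).card < 4) : A.erase s = B.erase r ∧ s ∈ A ∧ r ∈ B := by
  have h1 := Finset.card_le_card (Finset.subset_union_left (s₁ := A.erase s) (s₂ := B.erase r))
  have h2 := Finset.card_le_card (Finset.subset_union_right (s₁ := A.erase s) (s₂ := B.erase r))
  have hs : s ∈ A := by
    by_contra hs
    rw [Finset.erase_eq_of_notMem hs] at h1 h
    omega
  have hr : r ∈ B := by
    by_contra hr
    rw [Finset.erase_eq_of_notMem hr] at h2 h
    omega
  rw [Finset.card_erase_of_mem hs] at h1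
  rw [Finset.card_erase_of_mem hr] at h2
  refine ⟨?_, hs, hr⟩
  rw [Finset.eq_of_subset_of_card_le
      (Finset.subset_union_left (s₁ := A.erase s) (s₂ := B.erase r))
      (by rw [Finset.card_erase_of_mem hs]; omega)]
  exact (Finset.eq_of_subset_of_card_le Finset.subset_union_right
      (by rw [Finset.card_erase_of_mem hr]; omega)).symm

/-- The choice of the first two colours on a cycle of length six, where the two neighbours of the
last block on either side are the same two vertices. -/
theorem exists_pair_card_union {X Y A B : Finset ℕ} (hX : 2 ≤ X.card) (hY : 2 ≤ Y.card)
    (hA : A.card = 4) (hB : B.card = 4) :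
    ∃ r ∈ X, ∃ s ∈ Y, r ≠ s ∧ 4 ≤ (A.erase s ∪ B.erase r).card := by
  by_contra! hbad
  have key : ∀ r ∈ X, ∀ s ∈ Y, r ≠ s → A.erase s = B.erase r ∧ s ∈ A ∧ r ∈ B :=
    fun r hr s hs hrs => mem_sdiff_of_card_erase_union_le hA hB (hbad r hr s hs hrs)
  obtain ⟨r, hr⟩ := Finset.card_pos.1 (by omega : 0 < X.card)
  obtain ⟨s, hs, hsr⟩ := Finset.exists_mem_ne (by omega : 1 < Y.card) r
  obtain ⟨r', hr', hrr⟩ := Finset.exists_mem_ne (by omega : 1 < X.card) r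
  obtain ⟨s', hs', hss⟩ := Finset.exists_mem_ne (by omega : 1 < Y.card) s
  have k1 := key r hr s hs hsr.symm
  have e1 := fun z => Finset.ext_iff.1 k1.1 z
  simp only [Finset.mem_erase] at e1
  by_cases h1 : r' = s
  · subst h1
    by_cases h2 : s' = r
    · subst h2
      have k2 := key r' hr' s' hs' hrr
      grind
    · have k2 := key r hr s' hs' (Ne.symm h2)
      have e2 := fun z => Finset.ext_iff.1 k2.1 z
      simp only [Finset.mem_erase] at e2
      grind
  · have k2 := key r' hr' s hs h1
    have e2 := fun z => Finset.ext_iff.1 k2.1 z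
    simp only [Finset.mem_erase] at e2
    grind

/-- Colouring of the square of an even cycle with positions `0, …, n - 1`: cyclically close
positions get distinct colours, the positions fall into blocks of four with distinct colours,
and when `n ≡ 2 [MOD 4]` the two remaining positions `0`, `1` avoid a prescribed pair of
colours. -/
theorem exists_seq_cycle_ne {n : ℕ} (hn : 4 ≤ n) (hev : Even n) (A : ℕ → Finset ℕ)
    (hA : ∀ i, (A i).card = 4) (F : Finset ℕ) (hF : F.card ≤ 2) :
    ∃ c : ℕ → ℕ, (∀ i < n, c i ∈ A i) ∧
      (∀ i j, i < j → j < n →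
        (j ≤ i + 2 ∨ i + n ≤ j + 2 ∨ (i + n % 4) / 4 = (j + n % 4) / 4) → c i ≠ c j) ∧
      (n % 4 = 2 → c 0 ∉ F ∧ c 1 ∉ F) := by
  have hsd : ∀ i, 2 ≤ (A i \ F).card := fun i => by
    have := Finset.le_card_sdiff F (A i)
    have := hA i
    omega
  obtain rfl | hn6 | ⟨m, rfl⟩ : n = 4 ∨ n = 6 ∨ ∃ m, n = m + 8 := by
    rcases Nat.lt_or_ge n 8 with h | h
    · rw [Nat.even_iff] at hev; omega
    · exact Or.inr (Or.inr ⟨n - 8, by omega⟩)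
  · obtain ⟨c, h1, h2⟩ := exists_seq_window_ne 4 A (fun i => by rw [hA]; omega) 4
    exact ⟨c, h1, fun i j hij hj _ => h2 i j hij (by omega) hj, by omega⟩
  · -- here the two positions before the last block are also the two positions after it
    subst hn6
    obtain ⟨r, hr, s, hs, hrs, hu⟩ :=
      exists_pair_card_union (hsd 0) (hsd 1) (hA 3) (hA 4)
    have e (x : ℕ) (i : ℕ) : 3 ≤ ((A i).erase x).card := by
      have := Finset.pred_card_le_card_erase (s := A i) (a := x)
      have := hA i
      omega
    have e2 (x y : ℕ) (i : ℕ) : 2 ≤ (((A i).erase x).erase y).card := by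
      have := Finset.pred_card_le_card_erase (s := (A i).erase x) (a := y)
      have := e x i
      omega
    obtain ⟨w₁, h₁, w₂, h₂, w₃, h₃, w₄, h₄, hw⟩ :=
      exists_distinct_four (e2 r s 2) (e s 3) (e r 4) (e2 r s 5) hu
    simp only [Finset.mem_erase, Finset.mem_sdiff] at h₁ h₂ h₃ h₄ hr hs
    let c : ℕ → ℕ := fun i => match i with
      | 0 => r | 1 => s | 2 => w₁ | 3 => w₂ | 4 => w₃ | _ => w₄
    refine ⟨c, ?_, ?_, fun _ => ⟨hr.2, hs.2⟩⟩
    · intro i hi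
      interval_cases i <;> simp only [c] <;> tauto
    · intro i j hij hj hcond
      interval_cases j <;> interval_cases i <;> first | omega | (simp only [c]; grind)
  · -- all but the last six positions are coloured greedily
    obtain ⟨g, g1, g2⟩ := exists_seq_window_ne 4 (fun i => if i < 2 then A i \ F else A i)
      (fun i => by
        have := hsd i
        have := hA i
        split_ifs <;> omega) (m + 2)
    have hgA : ∀ i < m + 2, g i ∈ A i := fun i hi => by
      have := g1 i hi
      split_ifs at this with h
      · exact (Finset.mem_sdiff.1 this).1
      · exact this
    have hgF : ∀ i < 2, g i ∉ F := fun i hi => by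
      have := g1 i (by omega)
      rw [if_pos hi] at this
      exact (Finset.mem_sdiff.1 this).2
    have e (x : ℕ) (i : ℕ) : 3 ≤ ((A i).erase x).card := by
      have := Finset.pred_card_le_card_erase (s := A i) (a := x)
      have := hA i
      omega
    have e2 (x y : ℕ) (i : ℕ) : 2 ≤ (((A i).erase x).erase y).card := by
      have := Finset.pred_card_le_card_erase (s := (A i).erase x) (a := y)
      have := e x i
      omega
    -- position `m + 3` is coloured before `m + 2`, so that it can avoid the obstruction `f`
    obtain ⟨f, hf⟩ := exists_forbidden_color (hA (m + 5)) (e (g 0) (m + 6))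
    obtain ⟨y₄, hy₄, hy⟩ := exists_mem_notMem_triple (g m) (g (m + 1)) f (hA (m + 3)).ge
    obtain ⟨y₃, hy₃, hy'⟩ := exists_mem_notMem_triple (g m) (g (m + 1)) y₄ (hA (m + 2)).ge
    obtain ⟨w₁, h₁, w₂, h₂, w₃, h₃, w₄, h₄, hw⟩ :=
      exists_distinct_four (e2 y₃ y₄ (m + 4)) (e y₄ (m + 5)) (e (g 0) (m + 6))
        (e2 (g 0) (g 1) (m + 7)) (hf y₄ hy.2.2)
    simp only [Finset.mem_erase] at h₁ h₂ h₃ h₄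
    let c : ℕ → ℕ := fun i => if i < m + 2 then g i else if i = m + 2 then y₃ else
      if i = m + 3 then y₄ else if i = m + 4 then w₁ else if i = m + 5 then w₂ else
      if i = m + 6 then w₃ else w₄
    have c0 : ∀ i < m + 2, c i = g i := fun i hi => by simp [c, hi]
    have c2 : c (m + 2) = y₃ := by simp [c]
    have c3 : c (m + 3) = y₄ := by simp [c]
    have c4 : c (m + 4) = w₁ := by simp [c]
    have c5 : c (m + 5) = w₂ := by simp [c]
    have c6 : c (m + 6) = w₃ := by simp [c]
    have c7 : c (m + 7) = w₄ := by simp [c]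
    have cm : c m = g m := c0 m (by omega)
    have cm1 : c (m + 1) = g (m + 1) := c0 _ (by omega)
    have c00 : c 0 = g 0 := c0 0 (by omega)
    have c01 : c 1 = g 1 := c0 1 (by omega)
    clear_value c
    refine ⟨c, ?_, ?_, fun _ => ⟨c00 ▸ hgF 0 (by omega), c01 ▸ hgF 1 (by omega)⟩⟩
    · intro i hi
      obtain h | rfl | rfl | rfl | rfl | rfl | rfl : i < m + 2 ∨ i = m + 2 ∨ i = m + 3 ∨
        i = m + 4 ∨ i = m + 5 ∨ i = m + 6 ∨ i = m + 7 := by omega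
      · rw [c0 i h]; exact hgA i h
      all_goals simp only [c2, c3, c4, c5, c6, c7]; tauto
    · intro i j hij hj hcond
      rw [Nat.even_iff] at hev
      obtain h | rfl | rfl | rfl | rfl | rfl | rfl : j < m + 2 ∨ j = m + 2 ∨ j = m + 3 ∨
        j = m + 4 ∨ j = m + 5 ∨ j = m + 6 ∨ j = m + 7 := by omega
      · rw [c0 i (by omega), c0 j h]
        exact g2 i j hij (by omega) h
      · obtain rfl | rfl : i = m ∨ i = m + 1 := by omega
        all_goals simp only [*]; grind
      · obtain rfl | rfl | rfl : i = m ∨ i = m + 1 ∨ i = m + 2 := by omega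
        all_goals simp only [*]; grind
      · obtain rfl | rfl : i = m + 2 ∨ i = m + 3 := by omega
        all_goals simp only [*]; grind
      · obtain rfl | rfl : i = m + 3 ∨ i = m + 4 := by omega
        all_goals simp only [*]; grind
      · obtain rfl | rfl | rfl : i = 0 ∨ i = m + 4 ∨ i = m + 5 := by omega
        all_goals simp only [*]; grind
      · obtain rfl | rfl | rfl | rfl | rfl :
          i = 0 ∨ i = 1 ∨ i = m + 4 ∨ i = m + 5 ∨ i = m + 6 := by omega
        all_goals simp only [*]; grind

/-- The square of a cycle of even length `n` is coloured from lists of size four with every colour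
used at most `n / 4` times, except for a set `D` of at most `n % 4` colours that are used once
more and that avoid a prescribed pair. -/
theorem exists_seq_cycle_card_le {n : ℕ} (hn : 4 ≤ n) (hev : Even n) (A : ℕ → Finset ℕ)
    (hA : ∀ i, (A i).card = 4) (F : Finset ℕ) (hF : F.card ≤ 2) :
    ∃ (c : ℕ → ℕ) (D : Finset ℕ), (∀ i < n, c i ∈ A i) ∧
      (∀ i j, i < j → j < n → (j ≤ i + 2 ∨ i + n ≤ j + 2) → c i ≠ c j) ∧
      D.card ≤ n % 4 ∧ Disjoint D F ∧
      ∀ x, ((Finset.range n).filter (c · = x)).card ≤ n / 4 + if x ∈ D then 1 else 0 := by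
  obtain ⟨c, h1, h2, h3⟩ := exists_seq_cycle_ne hn hev A hA F hF
  have hb : ∀ i j, i < j → j < n → (i + n % 4) / 4 = (j + n % 4) / 4 → c i ≠ c j :=
    fun i j hij hj h => h2 i j hij hj (Or.inr (Or.inr h))
  have hp : ∀ i j, i < j → j < n → (j ≤ i + 2 ∨ i + n ≤ j + 2) → c i ≠ c j :=
    fun i j hij hj h => h2 i j hij hj (by tauto)
  rw [Nat.even_iff] at hev
  rcases (by omega : n % 4 = 0 ∨ n % 4 = 2) with h0 | h0
  · refine ⟨c, ∅, h1, hp, by simp, by simp, fun x => ?_⟩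
    have := card_color_le (by omega : 0 < 4) hb x
    simp only [Finset.notMem_empty, if_false]
    omega
  · refine ⟨c, {c 0, c 1}, h1, hp, by rw [h0]; exact Finset.card_le_two, ?_, fun x => ?_⟩
    · rw [Finset.disjoint_left]
      intro x hx
      simp only [Finset.mem_insert, Finset.mem_singleton] at hx
      rcases hx with rfl | rfl
      exacts [(h3 h0).1, (h3 h0).2]
    · have := card_color_le (by omega : 0 < 4) hb x
      split_ifs with hx
      · omega
      · have := card_color_lt (by omega : 0 < 4) (by omega) hb (x := x) (fun i _ hi => by
          simp only [Finset.mem_insert, Finset.mem_singleton, not_or] at hx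
          obtain rfl | rfl : i = 0 ∨ i = 1 := by omega
          exacts [Ne.symm hx.1, Ne.symm hx.2])
        omega

/-- The square of a path is coloured from lists of size `k` so that it completes an initial block of
`o` already used places whose colours are in `D`: every colour is used at most once per block,
the colours of `D` not in the initial block. -/
theorem exists_seq_path_card_le {k o : ℕ} (hk : 0 < k) (A : ℕ → Finset ℕ)
    (hA : ∀ i, (A i).card = k) (D : Finset ℕ) (hD : D.card ≤ o) (ho : o < k) (n : ℕ) :
    ∃ c : ℕ → ℕ, (∀ i < n, c i ∈ A i) ∧
      (∀ i j, i < j → j < n → j < i + k → c i ≠ c j) ∧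
      ∀ x, ((Finset.range n).filter (c · = x)).card + (if x ∈ D then 1 else 0) ≤
        (n + o + k - 1) / k := by
  obtain ⟨c, h1, h2⟩ := exists_seq_window_ne k (fun i => if i + o < k then A i \ D else A i)
    (fun i => by
      have := hA i
      have := Finset.le_card_sdiff D (A i)
      split_ifs <;> omega) n
  have hb : ∀ i j, i < j → j < n → (i + o) / k = (j + o) / k → c i ≠ c j := by
    intro i j hij hj h
    refine h2 i j hij ?_ hj
    have := Nat.div_add_mod (i + o) k
    have := Nat.div_add_mod (j + o) k
    have := Nat.mod_lt (j + o) hk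
    rw [h] at *
    omega
  refine ⟨c, fun i hi => ?_, fun i j hij hj h => h2 i j hij h hj, fun x => ?_⟩
  · have := h1 i hi
    split_ifs at this
    · exact (Finset.mem_sdiff.1 this).1
    · exact this
  · split_ifs with hx
    · have : 0 < D.card := Finset.card_pos.2 ⟨x, hx⟩
      refine card_color_lt hk (by omega) hb fun i hi hio => ?_
      rintro rfl
      have := h1 i hi
      rw [if_pos hio] at this
      exact (Finset.mem_sdiff.1 this).2 hx
    · exact card_color_le hk hb x

/-! ### Colouring graphs along lists of vertices -/

section

variable {W : Type*}

/-- `x` and `y` occur in the list `l` at positions that differ by at most `d`. -/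
def List.WithinDist (d : ℕ) (l : List W) (x y : W) : Prop :=
  ∃ i j, l[i]? = some x ∧ l[j]? = some y ∧ i ≤ j + d ∧ j ≤ i + d

/-- `x` and `y` occur in the list `l`, read cyclically, at positions at distance at most `d`. -/
def List.CyclicWithinDist (d : ℕ) (l : List W) (x y : W) : Prop :=
  ∃ i j, l[i]? = some x ∧ l[j]? = some y ∧
    ((i ≤ j + d ∧ j ≤ i + d) ∨ i + l.length ≤ j + d ∨ j + l.length ≤ i + d)

theorem List.WithinDist.mono {d d' : ℕ} {l : List W} {x y : W} (h : l.WithinDist d x y)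
    (hd : d ≤ d') : l.WithinDist d' x y := by
  obtain ⟨i, j, hi, hj, h1, h2⟩ := h
  exact ⟨i, j, hi, hj, by omega, by omega⟩

theorem List.WithinDist.of_infix {d : ℕ} {l l' : List W} {x y : W} (h : l.WithinDist d x y)
    (hl : l <:+: l') : l'.WithinDist d x y := by
  obtain ⟨s, t, rfl⟩ := hl
  obtain ⟨i, j, hi, hj, h1, h2⟩ := h
  obtain ⟨hi', hix⟩ := List.getElem?_eq_some_iff.1 hi
  obtain ⟨hj', hjx⟩ := List.getElem?_eq_some_iff.1 hj
  refine ⟨s.length + i, s.length + j, ?_, ?_, by omega, by omega⟩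
  · rw [List.append_assoc, List.getElem?_append_right (by omega), List.getElem?_append_left] <;>
      simp [hix, hi']
  · rw [List.append_assoc, List.getElem?_append_right (by omega), List.getElem?_append_left] <;>
      simp [hjx, hj']

theorem List.infix_flatten_of_mem {ls : List (List W)} {l : List W} (h : l ∈ ls) :
    l <:+: ls.flatten := by
  obtain ⟨s, t, rfl⟩ := List.append_of_mem h
  exact ⟨s.flatten, t.flatten, by simp⟩

theorem List.CyclicWithinDist.mem_left {d : ℕ} {l : List W} {x y : W}
    (h : l.CyclicWithinDist d x y) : x ∈ l := by
  obtain ⟨i, j, hi, -⟩ := h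
  exact List.mem_of_getElem? hi

theorem List.CyclicWithinDist.mem_right {d : ℕ} {l : List W} {x y : W}
    (h : l.CyclicWithinDist d x y) : y ∈ l := by
  obtain ⟨i, j, -, hj, -⟩ := h
  exact List.mem_of_getElem? hj

theorem List.WithinDist.mem_left {d : ℕ} {l : List W} {x y : W}
    (h : l.WithinDist d x y) : x ∈ l := by
  obtain ⟨i, j, hi, -⟩ := h
  exact List.mem_of_getElem? hi

theorem List.WithinDist.mem_right {d : ℕ} {l : List W} {x y : W}
    (h : l.WithinDist d x y) : y ∈ l := by
  obtain ⟨i, j, -, hj, -⟩ := h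
  exact List.mem_of_getElem? hj

/-- The reordering `x₀, xₙ₋₁, x₁, xₙ₋₂, …` of `x₀, …, xₙ₋₁`, which keeps cyclically close entries
close. -/
def List.zigzag : List W → List W
  | [] => []
  | x :: l => x :: List.zigzag l.reverse
termination_by l => l.length

theorem List.zigzag_perm (l : List W) : l.zigzag.Perm l := by
  induction h : l.length generalizing l with
  | zero => rw [List.length_eq_zero_iff.1 h]; simp [List.zigzag]
  | succ n ih =>
    cases l with
    | nil => simp at h
    | cons x l =>
      rw [List.zigzag]
      exact ((ih l.reverse (by simpa using h)).trans l.reverse_perm).cons x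

theorem List.getElem?_zigzag (l : List W) {t : ℕ} (ht : t < l.length) :
    l.zigzag[t]? = l[if t % 2 = 0 then t / 2 else l.length - 1 - t / 2]? := by
  induction h : l.length generalizing l t with
  | zero => omega
  | succ n ih =>
    cases l with
    | nil => simp at h
    | cons x l =>
      rw [List.zigzag]
      simp only [List.length_cons, Nat.add_right_cancel_iff] at h ht
      cases t with
      | zero => simp
      | succ t =>
        rw [List.getElem?_cons_succ, ih l.reverse (by simp; omega) (by simpa using h)]
        rcases Nat.mod_two_eq_zero_or_one t with h2 | h2
        · rw [if_pos h2, if_neg (by omega), List.getElem?_reverse (by omega),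
            show n + 1 - 1 - (t + 1) / 2 = (l.length - 1 - t / 2) + 1 by omega,
            List.getElem?_cons_succ]
        · rw [if_neg (by omega), if_pos (by omega), List.getElem?_reverse (by omega),
            show (t + 1) / 2 = (l.length - 1 - (n - 1 - t / 2)) + 1 by omega,
            List.getElem?_cons_succ]

theorem List.getElem?_zigzag_inv (l : List W) {i : ℕ} (hi : i < l.length) :
    l.zigzag[if 2 * i < l.length then 2 * i else 2 * (l.length - 1 - i) + 1]? = l[i]? := by
  rw [List.getElem?_zigzag _ (by split_ifs <;> omega)]
  congr 1
  split_ifs <;> omega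

theorem List.CyclicWithinDist.zigzag {d : ℕ} {l : List W} {x y : W}
    (h : l.CyclicWithinDist d x y) : l.zigzag.WithinDist (2 * d) x y := by
  obtain ⟨i, j, hi, hj, hij⟩ := h
  obtain ⟨hi', -⟩ := List.getElem?_eq_some_iff.1 hi
  obtain ⟨hj', -⟩ := List.getElem?_eq_some_iff.1 hj
  refine ⟨_, _, (l.getElem?_zigzag_inv hi').trans hi, (l.getElem?_zigzag_inv hj').trans hj, ?_⟩
  split_ifs <;> omega

theorem List.count_map_range (c : ℕ → ℕ) (n x : ℕ) :
    ((List.range n).map c).count x = ((Finset.range n).filter (c · = x)).card := by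
  rw [List.count, List.countP_map, List.countP_eq_length_filter]
  congr 1

namespace SimpleGraph

variable {H : SimpleGraph W} {L : W → Finset ℕ}

/-- `f` is a proper `L`-colouring of the subgraph of `H` induced by the entries of `S`. -/
def IsListColoringOn (H : SimpleGraph W) (L : W → Finset ℕ) (S : List W) (f : W → ℕ) : Prop :=
  (∀ v ∈ S, f v ∈ L v) ∧ ∀ v ∈ S, ∀ w ∈ S, H.Adj v w → f v ≠ f w

/-- The list assigned to the position `i` of `S`. The value beyond the end of `S` is arbitrary; a
set of `k` colours keeps all sizes equal to `k`. -/
def listAt (L : W → Finset ℕ) (k : ℕ) (S : List W) (i : ℕ) : Finset ℕ :=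
  if h : i < S.length then L S[i] else Finset.range k

theorem card_listAt {k : ℕ} (hL : IsAssignment L k) (S : List W) (i : ℕ) :
    (listAt L k S i).card = k := by
  unfold listAt
  split_ifs
  · exact hL _
  · simp

/-- A colouring of the positions of a list gives a colouring of its entries. -/
theorem exists_isListColoringOn_of_seq {k : ℕ} {S : List W} (hS : S.Nodup) {c : ℕ → ℕ}
    (hc : ∀ i < S.length, c i ∈ listAt L k S i)
    (hadj : ∀ x ∈ S, ∀ y ∈ S, H.Adj x y →
      ∃ i j, S[i]? = some x ∧ S[j]? = some y ∧ c i ≠ c j) :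
    ∃ f, H.IsListColoringOn L S f ∧
      ∀ x, (S.map f).count x = ((Finset.range S.length).filter (c · = x)).card := by
  classical
  have key : ∀ i (hi : i < S.length), c (S.idxOf S[i]) = c i := fun i hi => by
    rw [hS.idxOf_getElem]
  refine ⟨fun v => c (S.idxOf v), ⟨?_, ?_⟩, fun x => ?_⟩
  · intro v hv
    obtain ⟨i, hi, rfl⟩ := List.getElem_of_mem hv
    have := hc i hi
    rw [listAt, dif_pos hi] at this
    simpa only [key i hi] using this
  · intro v hv w hw h
    obtain ⟨i, j, hi, hj, hij⟩ := hadj v hv w hw h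
    obtain ⟨hi', rfl⟩ := List.getElem?_eq_some_iff.1 hi
    obtain ⟨hj', rfl⟩ := List.getElem?_eq_some_iff.1 hj
    simpa only [key i hi', key j hj'] using hij
  · rw [← List.count_map_range]
    congr 1
    apply List.ext_getElem
    · simp
    · intro i h1 h2
      simp only [List.length_map] at h1
      simpa using key i h1

theorem IsListColoringOn.exists_append {S T : List W} {f g : W → ℕ}
    (hf : H.IsListColoringOn L S f) (hg : H.IsListColoringOn L T g) (hST : S.Disjoint T)
    (hadj : ∀ x ∈ S, ∀ y ∈ T, ¬ H.Adj x y) :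
    ∃ p, H.IsListColoringOn L (S ++ T) p ∧
      ∀ x, ((S ++ T).map p).count x = (S.map f).count x + (T.map g).count x := by
  classical
  let p : W → ℕ := fun v => if v ∈ S then f v else g v
  have hpS : ∀ v ∈ S, p v = f v := fun v hv => if_pos hv
  have hpT : ∀ v ∈ T, p v = g v := fun v hv => if_neg fun h => hST h hv
  refine ⟨p, ⟨?_, ?_⟩, fun x => ?_⟩
  · intro v hv
    rcases List.mem_append.1 hv with h | h
    · rw [hpS v h]; exact hf.1 v h
    · rw [hpT v h]; exact hg.1 v h
  · intro v hv w hw h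
    rcases List.mem_append.1 hv with hv | hv <;> rcases List.mem_append.1 hw with hw | hw
    · rw [hpS v hv, hpS w hw]; exact hf.2 v hv w hw h
    · exact absurd h (hadj v hv w hw)
    · exact absurd h.symm (hadj w hw v hv)
    · rw [hpT v hv, hpT w hw]; exact hg.2 v hv w hw h
  · rw [List.map_append, List.count_append, List.map_congr_left hpS, List.map_congr_left hpT]

theorem IsListColoringOn.isEquitableListColoring {k : ℕ} (hk : 0 < k) {S : List W} {f : W → ℕ}
    (hf : H.IsListColoringOn L S f) (hS : S.Nodup) (hmem : ∀ x, x ∈ S)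
    (hcount : ∀ x, (S.map f).count x ≤ (S.length + k - 1) / k) :
    H.IsEquitableListColoring L k f := by
  classical
  refine ⟨⟨fun v => hf.1 v (hmem v), fun v w => hf.2 v (hmem v) w (hmem w)⟩, fun x => ?_⟩
  have hcard : Nat.card W = S.length := by
    rw [← Set.ncard_univ, show (Set.univ : Set W) = S.toFinset by ext; simp [hmem],
      Set.ncard_coe_finset, List.toFinset_card_of_nodup hS]
  have hset : {v | f v = x} = ((S.filter (f · = x)).toFinset : Set W) := by
    ext; simp [hmem]
  rw [hset, Set.ncard_coe_finset, List.toFinset_card_of_nodup (hS.filter _),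
    ← List.countP_eq_length_filter, hcard]
  have h1 : (S.map f).count x = S.countP (f · = x) := by
    rw [List.count, List.countP_map]; rfl
  have h2 := hcount x
  rw [h1] at h2
  refine h2.trans ?_
  have h3 : (S.length : ℚ) / k ≤ (⌈(S.length : ℚ) / k⌉₊ : ℚ) := Nat.le_ceil _
  rw [div_le_iff₀ (by exact_mod_cast hk)] at h3
  have h4 : S.length ≤ ⌈(S.length : ℚ) / k⌉₊ * k := by exact_mod_cast h3
  rw [← Nat.lt_succ_iff, Nat.div_lt_iff_lt_mul hk, Nat.succ_mul]
  omega

/-- A graph whose vertices can be listed so that adjacent ones are at distance at most `k - 1` is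
equitably `k`-choosable. -/
theorem equitablyChoosable_of_withinDist {k : ℕ} (hk : 0 < k) {S : List W} (hS : S.Nodup)
    (hmem : ∀ x, x ∈ S) (hadj : ∀ x y, H.Adj x y → S.WithinDist (k - 1) x y) :
    H.EquitablyChoosable k := by
  intro L hL
  obtain ⟨c, h1, h2, h3⟩ := exists_seq_path_card_le hk (listAt L k S) (card_listAt hL S) ∅
    (o := 0) (by simp) hk S.length
  obtain ⟨f, hf, hcount⟩ := exists_isListColoringOn_of_seq (H := H) hS h1 fun x _ y _ hxy => by
    obtain ⟨i, j, hi, hj, hij⟩ := hadj x y hxy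
    refine ⟨i, j, hi, hj, ?_⟩
    obtain ⟨hi', rfl⟩ := List.getElem?_eq_some_iff.1 hi
    obtain ⟨hj', rfl⟩ := List.getElem?_eq_some_iff.1 hj
    rcases lt_trichotomy i j with h | rfl | h
    · exact h2 i j h hj' (by omega)
    · exact absurd hxy (H.irrefl)
    · exact (h2 j i h hi' (by omega)).symm
  refine ⟨f, hf.isEquitableListColoring hk hS hmem fun x => ?_⟩
  have := h3 x
  rw [hcount]
  simpa using this

/-- Disjoint squares of even cycles, of total length `N`, are coloured from lists of size four with
every colour used at most `N / 4` times, except for at most `N % 4` colours used once more. A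
cycle of length `2` modulo `4` is coloured so that its excess colours differ from those left
over before it, and then the four excess colours fill one block. -/
theorem exists_isListColoringOn_cycles (hL : IsAssignment L 4) (cs : List (List W))
    (hnd : cs.flatten.Nodup) (hcs : ∀ c ∈ cs, 4 ≤ c.length ∧ Even c.length)
    (hadj : ∀ x ∈ cs.flatten, ∀ y ∈ cs.flatten, H.Adj x y → ∃ c ∈ cs, c.CyclicWithinDist 2 x y) :
    ∃ (f : W → ℕ) (D : Finset ℕ), H.IsListColoringOn L cs.flatten f ∧
      Even cs.flatten.length ∧ D.card ≤ cs.flatten.length % 4 ∧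
      ∀ x, (cs.flatten.map f).count x ≤ cs.flatten.length / 4 + if x ∈ D then 1 else 0 := by
  induction cs with
  | nil => exact ⟨fun _ => 0, ∅, ⟨by simp, by simp⟩, by simp, by simp, by simp⟩
  | cons l cs ih =>
    rw [List.flatten_cons] at hnd hadj ⊢
    obtain ⟨hl, hcsnd, hdisj⟩ := List.nodup_append'.1 hnd
    obtain ⟨g, E, hg, hgev, hE, hgc⟩ := ih hcsnd (fun c hc => hcs c (List.mem_cons_of_mem _ hc))
      fun x hx y hy hxy => by
        obtain ⟨c, hc, hcxy⟩ := hadj x (List.mem_append_right _ hx) y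
          (List.mem_append_right _ hy) hxy
        rcases List.mem_cons.1 hc with rfl | hc
        · exact absurd hx (hdisj hcxy.mem_left)
        · exact ⟨c, hc, hcxy⟩
    rw [Nat.even_iff] at hgev
    obtain ⟨h4, hev⟩ := hcs l (by simp)
    obtain ⟨c, D, h1, h2, hD, hDE, h3⟩ := exists_seq_cycle_card_le h4 hev (listAt L 4 l)
      (card_listAt hL l) E (by omega)
    obtain ⟨f, hf, hfc⟩ := exists_isListColoringOn_of_seq (H := H) hl h1
      fun x hx y hy hxy => by
        obtain ⟨l', hl', hlxy⟩ := hadj x (List.mem_append_left _ hx) y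
          (List.mem_append_left _ hy) hxy
        rcases List.mem_cons.1 hl' with rfl | hl'
        · obtain ⟨i, j, hi, hj, hij⟩ := hlxy
          refine ⟨i, j, hi, hj, ?_⟩
          obtain ⟨hi', rfl⟩ := List.getElem?_eq_some_iff.1 hi
          obtain ⟨hj', rfl⟩ := List.getElem?_eq_some_iff.1 hj
          rcases lt_trichotomy i j with h | rfl | h
          · exact h2 i j h hj' (by omega)
          · exact absurd hxy (H.irrefl)
          · exact (h2 j i h hi' (by omega)).symm
        · exact absurd (List.mem_flatten_of_mem hl' hlxy.mem_left) (hdisj hx)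
    obtain ⟨p, hp, hpc⟩ := hf.exists_append hg hdisj fun x hx y hy hxy => by
      obtain ⟨l', hl', hlxy⟩ := hadj x (List.mem_append_left _ hx) y
        (List.mem_append_right _ hy) hxy
      rcases List.mem_cons.1 hl' with rfl | hl'
      · exact hdisj hlxy.mem_right hy
      · exact hdisj hx (List.mem_flatten_of_mem hl' hlxy.mem_left)
    rw [Nat.even_iff] at hev
    refine ⟨p, if l.length % 4 = 2 ∧ cs.flatten.length % 4 = 2 then ∅ else D ∪ E, hp, ?_, ?_, ?_⟩
    · rw [List.length_append, Nat.even_iff]; omega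
    · rw [List.length_append]
      have := Finset.card_union_le D E
      split_ifs
      · simp
      · omega
    · intro x
      have hx1 := h3 x
      have hx2 := hgc x
      rw [hpc, hfc, List.length_append]
      have hor : x ∈ D → x ∉ E := fun h => Finset.disjoint_left.1 hDE h
      split_ifs with hif hmem hmem
      · simp at hmem
      · split_ifs at hx1 hx2 with hxD hxE hxE
        · exact absurd hxE (hor hxD)
        all_goals omega
      · split_ifs at hx1 hx2 with hxD hxE hxE
        · exact absurd hxE (hor hxD)
        all_goals omega
      · rw [Finset.mem_union, not_or] at hmem
        rw [if_neg hmem.1] at hx1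
        rw [if_neg hmem.2] at hx2
        omega

/-- A disjoint union of squares of even cycles and subgraphs of squares of paths is equitably
`4`-choosable. -/
theorem equitablyChoosable_four {P : List W} {cs : List (List W)}
    (hnd : (P ++ cs.flatten).Nodup) (hmem : ∀ x, x ∈ P ++ cs.flatten)
    (hcs : ∀ c ∈ cs, 4 ≤ c.length ∧ Even c.length)
    (hadj : ∀ x y, H.Adj x y → P.WithinDist 2 x y ∨ ∃ c ∈ cs, c.CyclicWithinDist 2 x y) :
    H.EquitablyChoosable 4 := by
  intro L hL
  obtain ⟨hP, hC, hdisj⟩ := List.nodup_append'.1 hnd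
  obtain ⟨g, D, hg, hev, hD, hgc⟩ := exists_isListColoringOn_cycles (H := H) hL cs hC hcs
    fun x hx y hy hxy => (hadj x y hxy).resolve_left fun h => hdisj h.mem_left hx
  obtain ⟨c, h1, h2, h3⟩ := exists_seq_path_card_le (by omega : 0 < 4) (listAt L 4 P)
    (card_listAt hL P) D hD (Nat.mod_lt _ (by omega)) P.length
  obtain ⟨f, hf, hfc⟩ := exists_isListColoringOn_of_seq (H := H) hP h1 fun x hx y hy hxy => by
    rcases hadj x y hxy with ⟨i, j, hi, hj, hij⟩ | ⟨l, hl, h⟩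
    · refine ⟨i, j, hi, hj, ?_⟩
      obtain ⟨hi', rfl⟩ := List.getElem?_eq_some_iff.1 hi
      obtain ⟨hj', rfl⟩ := List.getElem?_eq_some_iff.1 hj
      rcases lt_trichotomy i j with h | rfl | h
      · exact h2 i j h hj' (by omega)
      · exact absurd hxy (H.irrefl)
      · exact (h2 j i h hi' (by omega)).symm
    · exact absurd (List.mem_flatten_of_mem hl h.mem_left) (hdisj hx)
  obtain ⟨p, hp, hpc⟩ := hf.exists_append hg hdisj fun x hx y hy hxy => by
    rcases hadj x y hxy with h | ⟨l, hl, h⟩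
    · exact hdisj h.mem_right hy
    · exact hdisj hx (List.mem_flatten_of_mem hl h.mem_left)
  refine ⟨p, hp.isEquitableListColoring (by omega) hnd hmem fun x => ?_⟩
  have hx1 := h3 x
  have hx2 := hgc x
  rw [hpc, hfc, List.length_append]
  omega

end SimpleGraph

/-! ### Decomposition into paths and cycles -/

theorem List.eq_of_mem_of_nodup_flatten {ls : List (List W)} (h : ls.flatten.Nodup) {l l' : List W}
    (hl : l ∈ ls) (hl' : l' ∈ ls) {x : W} (hx : x ∈ l) (hx' : x ∈ l') : l = l' := by
  obtain ⟨s, t, rfl⟩ := List.append_of_mem hl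
  simp only [List.flatten_append, List.flatten_cons, List.nodup_append', List.disjoint_append_right]
    at h
  rcases List.mem_append.1 hl' with hm | hm
  · exact absurd hx (h.2.2.1 (List.mem_flatten_of_mem hm hx'))
  · rcases List.mem_cons.1 hm with rfl | hm
    · rfl
    · exact absurd (List.mem_flatten_of_mem hm hx') (h.2.1.2.2 hx)

namespace IncidenceList

variable {V E : Type*} {I : V → E → Prop}

/-- The incidence relation `I` between vertices and edges as a symmetric relation on `V ⊕ E`: the
adjacency relation of the subdivision of the multigraph. -/
def Consec (I : V → E → Prop) : V ⊕ E → V ⊕ E → Prop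
  | .inl v, .inr e => I v e
  | .inr e, .inl v => I v e
  | _, _ => False

theorem Consec.symm {x y : V ⊕ E} (h : Consec I x y) : Consec I y x := by
  rcases x with v | e <;> rcases y with w | f <;> exact h

/-- The elements `v₀, e₁, v₁, …, eₙ, vₙ` of a path: consecutive ones are incident, and both ends are
vertices. -/
structure IsPathList (I : V → E → Prop) (l : List (V ⊕ E)) : Prop where
  chain : l.IsChain (Consec I)
  odd : Odd l.length
  head : ∀ x ∈ l.head?, x.isLeft
  last : ∀ x ∈ l.getLast?, x.isLeft

/-- The elements `e, v₀, e₁, v₁, …, eₙ, vₙ` of a cycle: a path with `n ≥ 1` together with an edge `e`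
joining its ends. -/
def IsCycleList (I : V → E → Prop) (c : List (V ⊕ E)) : Prop :=
  ∃ e p, c = .inr e :: p ∧ IsPathList I p ∧ 1 < p.length ∧
    (.inr e :: (p ++ [.inr e])).IsChain (Consec I)

theorem IsPathList.reverse {l : List (V ⊕ E)} (h : IsPathList I l) : IsPathList I l.reverse where
  chain := List.isChain_reverse.2 (h.chain.imp fun _ _ => Consec.symm)
  odd := by simpa using h.odd
  head := by simpa using h.last
  last := by simpa using h.head

theorem IsPathList.append_cons {p q : List (V ⊕ E)} {e : E} {u v : V} (hp : IsPathList I p)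
    (hq : IsPathList I q) (hpu : p.getLast? = some (.inl u)) (hqv : q.head? = some (.inl v))
    (hu : I u e) (hv : I v e) : IsPathList I (p ++ .inr e :: q) where
  chain := by
    refine hp.chain.append (List.isChain_cons.2 ⟨?_, hq.chain⟩) ?_
    · simp only [hqv, Option.mem_some_iff, forall_eq']
      exact hv
    · simp only [hpu, List.head?_cons, Option.mem_some_iff, forall_eq']
      exact hu
  odd := by
    have h1 := hp.odd
    have h2 := hq.odd
    rw [Nat.odd_iff] at *
    simp only [List.length_append, List.length_cons]
    omega
  head := by
    cases p with
    | nil => simp at hpu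
    | cons x p => simpa using hp.head
  last := by
    cases q with
    | nil => simp at hqv
    | cons x q => simpa using hq.last

theorem IsCycleList.even_length {c : List (V ⊕ E)} (h : IsCycleList I c) :
    4 ≤ c.length ∧ Even c.length := by
  obtain ⟨e, p, rfl, hp, hlt, -⟩ := h
  have := hp.odd
  rw [Nat.odd_iff] at this
  rw [List.length_cons, Nat.even_iff]
  omega

/-- An interior vertex of a list of consecutively incident elements has two incident edges there. -/
theorem exists_edges_of_interior {x y : V ⊕ E} {u : V} {s t : List (V ⊕ E)}
    (h : (s ++ x :: .inl u :: y :: t).IsChain (Consec I)) (hxy : x ≠ y) :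
    ∃ e₁ e₂, e₁ ≠ e₂ ∧ I u e₁ ∧ I u e₂ ∧ x = .inr e₁ ∧ y = .inr e₂ := by
  simp only [List.isChain_append_cons_cons, List.isChain_cons_cons] at h
  obtain ⟨-, h1, h2, -⟩ := h
  rcases x with x | x
  · exact h1.elim
  rcases y with y | y
  · exact h2.elim
  exact ⟨x, y, fun h => hxy (by rw [h]), h1, h2, rfl, rfl⟩

theorem IsCycleList.exists_edges {c : List (V ⊕ E)} (h : IsCycleList I c) (hnd : c.Nodup) :
    ∃ u e₁ e₂, e₁ ≠ e₂ ∧ I u e₁ ∧ I u e₂ := by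
  obtain ⟨e, p, rfl, -, hlt, hch⟩ := h
  match p, hlt with
  | .inr f :: y :: l, _ => exact (List.isChain_cons_cons.1 hch).1.elim
  | .inl u :: y :: l, _ =>
    obtain ⟨e₁, e₂, hne, h1, h2, -⟩ := exists_edges_of_interior (x := .inr e) (y := y) (s := [])
      (t := l ++ [Sum.inr e]) hch (by rintro rfl; simp at hnd)
    exact ⟨u, e₁, e₂, hne, h1, h2⟩

/-- The lists `ps` of paths and `cs` of cycles partition the vertices and the edges in `F`. -/
structure IsDecomposition (I : V → E → Prop) (F : Finset E) (ps cs : List (List (V ⊕ E))) :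
    Prop where
  path : ∀ p ∈ ps, IsPathList I p
  cycle : ∀ c ∈ cs, IsCycleList I c
  nodup : (ps.flatten ++ cs.flatten).Nodup
  vertex_mem : ∀ v, .inl v ∈ ps.flatten ++ cs.flatten
  edge_mem_iff : ∀ e, .inr e ∈ ps.flatten ++ cs.flatten ↔ e ∈ F

variable {F : Finset E} {ps ps' cs : List (List (V ⊕ E))}

theorem IsDecomposition.perm (h : IsDecomposition I F ps cs) (hps : ps.Perm ps') :
    IsDecomposition I F ps' cs := by
  have hperm : (ps.flatten ++ cs.flatten).Perm (ps'.flatten ++ cs.flatten) :=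
    hps.flatten.append_right _
  exact ⟨fun p hp => h.path p (hps.mem_iff.2 hp), h.cycle, hperm.nodup_iff.1 h.nodup,
    fun v => hperm.mem_iff.1 (h.vertex_mem v), fun e => hperm.mem_iff.symm.trans (h.edge_mem_iff e)⟩

theorem IsDecomposition.reverse {p : List (V ⊕ E)} (h : IsDecomposition I F (p :: ps) cs) :
    IsDecomposition I F (p.reverse :: ps) cs := by
  have hperm : ((p :: ps).flatten ++ cs.flatten).Perm ((p.reverse :: ps).flatten ++ cs.flatten) := by
    simp only [List.flatten_cons]
    exact (p.reverse_perm.symm.append_right _).append_right _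
  refine ⟨fun q hq => ?_, h.cycle, hperm.nodup_iff.1 h.nodup,
    fun v => hperm.mem_iff.1 (h.vertex_mem v), fun e => hperm.mem_iff.symm.trans (h.edge_mem_iff e)⟩
  rcases List.mem_cons.1 hq with rfl | hq
  · exact (h.path p (by simp)).reverse
  · exact h.path q (by simp [hq])

/-- A vertex with at most two edges, one of which is not in `F`, is an end of a path of the
decomposition. -/
theorem IsDecomposition.exists_end (h : IsDecomposition I F ps cs) {e : E} {u : V} (he : e ∉ F)
    (hu : I u e) (hdeg : ∀ e₁ e₂, I u e₁ → I u e₂ → e₁ = e₂ ∨ e₁ = e ∨ e₂ = e) :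
    ∃ p ∈ ps, p.head? = some (.inl u) ∨ p.getLast? = some (.inl u) := by
  have key : ∀ {x y : V ⊕ E} {s t : List (V ⊕ E)},
      (s ++ x :: .inl u :: y :: t).IsChain (Consec I) → x ≠ y →
      x ∈ ps.flatten ++ cs.flatten → y ∈ ps.flatten ++ cs.flatten → False := by
    intro x y s t hch hxy hx hy
    obtain ⟨e₁, e₂, hne, h1, h2, rfl, rfl⟩ := exists_edges_of_interior hch hxy
    rw [h.edge_mem_iff] at hx hy
    rcases hdeg e₁ e₂ h1 h2 with h | rfl | rfl
    · exact hne h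
    · exact he hx
    · exact he hy
  rcases List.mem_append.1 (h.vertex_mem u) with hm | hm
  · obtain ⟨p, hp, hup⟩ := List.mem_flatten.1 hm
    refine ⟨p, hp, ?_⟩
    have hsub : ∀ x ∈ p, x ∈ ps.flatten ++ cs.flatten :=
      fun x hx => List.mem_append_left _ (List.mem_flatten_of_mem hp hx)
    have hpnd : p.Nodup :=
      h.nodup.sublist ((List.infix_flatten_of_mem hp).sublist.trans (List.sublist_append_left _ _))
    have hch := (h.path p hp).chain
    obtain ⟨s, t, rfl⟩ := List.append_of_mem hup
    rcases List.eq_nil_or_concat s with rfl | ⟨s, x, rfl⟩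
    · exact Or.inl rfl
    · cases t with
      | nil => right; simp
      | cons y t =>
        simp only [List.concat_eq_append, List.append_assoc, List.cons_append, List.nil_append]
          at hch hpnd hsub
        refine (key hch ?_ (hsub x (by simp)) (hsub y (by simp))).elim
        rintro rfl
        simp [List.nodup_append] at hpnd
  · obtain ⟨c, hc, huc⟩ := List.mem_flatten.1 hm
    have hsub : ∀ x ∈ c, x ∈ ps.flatten ++ cs.flatten :=
      fun x hx => List.mem_append_right _ (List.mem_flatten_of_mem hc hx)
    have hcnd : c.Nodup :=
      h.nodup.sublist ((List.infix_flatten_of_mem hc).sublist.trans (List.sublist_append_right _ _))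
    obtain ⟨e₀, p, rfl, hp, hlt, hch⟩ := h.cycle c hc
    have hup : .inl u ∈ p := by simpa using huc
    obtain ⟨s, t, rfl⟩ := List.append_of_mem hup
    exfalso
    rcases List.eq_nil_or_concat s with rfl | ⟨s, x, rfl⟩
    · cases t with
      | nil => simp at hlt
      | cons y t =>
        refine key (x := .inr e₀) (y := y) (s := []) (t := t ++ [Sum.inr e₀])
          (by simpa using hch) ?_ (hsub _ (by simp)) (hsub y (by simp))
        rintro rfl
        simp at hcnd
    · simp only [List.concat_eq_append, List.append_assoc, List.cons_append, List.nil_append]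
          at hch hcnd hsub
      cases t with
      | nil =>
        refine key (s := .inr e₀ :: s) (t := []) hch ?_ (hsub x (by simp)) (hsub _ (by simp))
        rintro rfl
        simp at hcnd
      | cons y t =>
        refine key (x := x) (y := y) (s := .inr e₀ :: s) (t := t ++ [Sum.inr e₀])
          (by simpa using hch) ?_ (hsub x (by simp))
          (hsub y (by simp))
        rintro rfl
        simp [List.nodup_append] at hcnd

/-- Adding an edge either closes a path to a cycle or joins two paths. -/
theorem IsDecomposition.exists_insert [DecidableEq E] (h : IsDecomposition I F ps cs) {e : E}
    {u v : V} (he : e ∉ F) (huv : u ≠ v) (hu : I u e) (hv : I v e)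
    (hdegu : ∀ e₁ e₂, I u e₁ → I u e₂ → e₁ = e₂ ∨ e₁ = e ∨ e₂ = e)
    (hdegv : ∀ e₁ e₂, I v e₁ → I v e₂ → e₁ = e₂ ∨ e₁ = e ∨ e₂ = e) :
    ∃ ps' cs', IsDecomposition I (insert e F) ps' cs' := by
  have hnew : ∀ {ps₀ cs₀ ps₁ cs₁ : List (List (V ⊕ E))}, IsDecomposition I F ps₀ cs₀ →
      (∀ p ∈ ps₁, IsPathList I p) → (∀ c ∈ cs₁, IsCycleList I c) →
      (ps₁.flatten ++ cs₁.flatten).Perm (.inr e :: (ps₀.flatten ++ cs₀.flatten)) →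
      IsDecomposition I (insert e F) ps₁ cs₁ := by
    intro ps₀ cs₀ ps₁ cs₁ h₀ hp hc hperm
    refine ⟨hp, hc, hperm.nodup_iff.2 (List.nodup_cons.2 ⟨?_, h₀.nodup⟩), fun w => ?_, fun f => ?_⟩
    · rwa [h₀.edge_mem_iff]
    · exact hperm.mem_iff.2 (List.mem_cons_of_mem _ (h₀.vertex_mem w))
    · rw [hperm.mem_iff, List.mem_cons, h₀.edge_mem_iff, Finset.mem_insert, Sum.inr.injEq]
  obtain ⟨p, ps₁, h₁, hpu⟩ : ∃ p ps₁, IsDecomposition I F (p :: ps₁) cs ∧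
      p.getLast? = some (.inl u) := by
    obtain ⟨p, hp, hpu⟩ := h.exists_end he hu hdegu
    obtain ⟨s, t, rfl⟩ := List.append_of_mem hp
    have h' := h.perm List.perm_middle
    rcases hpu with hpu | hpu
    · exact ⟨_, _, h'.reverse, by simpa using hpu⟩
    · exact ⟨_, _, h', hpu⟩
  have hpp := h₁.path p (by simp)
  obtain ⟨q, hq, hqv⟩ := h₁.exists_end he hv hdegv
  rcases List.mem_cons.1 hq with rfl | hq
  · have hqv : q.head? = some (.inl v) := by
      rcases hqv with hqv | hqv
      · exact hqv
      · rw [hpu, Option.some_inj, Sum.inl.injEq] at hqv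
        exact absurd hqv huv
    refine ⟨ps₁, (.inr e :: q) :: cs, hnew h₁ (fun p hp => h₁.path p (by simp [hp])) ?_ ?_⟩
    · intro c hc
      rcases List.mem_cons.1 hc with rfl | hc
      · refine ⟨e, q, rfl, hpp, ?_, ?_⟩
        · match q, hpu, hqv with
          | [x], hpu, hqv =>
            simp only [List.getLast?_singleton, List.head?_cons, Option.some_inj] at hpu hqv
            rw [hpu, Sum.inl.injEq] at hqv
            exact absurd hqv huv
          | x :: y :: l, _, _ => simp
        · refine List.isChain_cons.2 ⟨?_, hpp.chain.append (List.isChain_singleton _) ?_⟩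
          · rw [List.head?_append, hqv]
            simp only [Option.some_or, Option.mem_some_iff, forall_eq']
            exact hv
          · simp only [hpu, List.head?_cons, Option.mem_some_iff, forall_eq']
            exact hu
      · exact h₁.cycle c hc
    · rw [List.flatten_cons, List.flatten_cons, List.cons_append]
      refine List.perm_middle.trans (List.Perm.cons _ ?_)
      rw [← List.append_assoc]
      exact List.perm_append_comm.append_right _
  · obtain ⟨s, t, rfl⟩ := List.append_of_mem hq
    have h₂ : IsDecomposition I F (q :: p :: (s ++ t)) cs :=
      h₁.perm ((List.perm_middle.cons p).trans (List.Perm.swap _ _ _))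
    obtain ⟨q', h₃, hqv'⟩ : ∃ q', IsDecomposition I F (q' :: p :: (s ++ t)) cs ∧
        q'.head? = some (.inl v) := by
      rcases hqv with hqv | hqv
      · exact ⟨q, h₂, hqv⟩
      · exact ⟨_, h₂.reverse, by simpa using hqv⟩
    have hpath := hpp.append_cons (h₃.path q' (by simp)) hpu hqv' hu hv
    refine ⟨(p ++ .inr e :: q') :: (s ++ t), cs, hnew h₃ ?_ h₃.cycle ?_⟩
    · intro r hr
      rcases List.mem_cons.1 hr with rfl | hr
      · exact hpath
      · exact h₃.path r (by simp only [List.mem_cons]; tauto)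
    · rw [List.flatten_cons, List.flatten_cons, List.flatten_cons,
        ← List.append_assoc q', ← List.cons_append, ← List.cons_append]
      exact (List.perm_append_comm.append_right _).append_right _

/-- A finite multigraph in which every edge has two ends and every vertex at most two edges is a
disjoint union of paths and cycles. -/
theorem exists_isDecomposition [Finite V] (hends : ∀ e, ∃ u v, u ≠ v ∧ I u e ∧ I v e)
    (hdeg : ∀ v e₁ e₂ e₃, I v e₁ → I v e₂ → I v e₃ → e₁ = e₂ ∨ e₁ = e₃ ∨ e₂ = e₃) (F : Finset E) :
    ∃ ps cs, IsDecomposition I F ps cs := by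
  classical
  induction F using Finset.induction_on with
  | empty =>
    have := Fintype.ofFinite V
    have hfl : ((Finset.univ : Finset V).toList.map fun v => [(.inl v : V ⊕ E)]).flatten =
        (Finset.univ : Finset V).toList.map .inl := by
      generalize (Finset.univ : Finset V).toList = l
      induction l with
      | nil => rfl
      | cons a l ih => simp [ih]
    refine ⟨(Finset.univ : Finset V).toList.map fun v => [.inl v], [], ⟨?_, by simp, ?_, ?_, ?_⟩⟩
    · intro p hp
      obtain ⟨v, -, rfl⟩ := List.mem_map.1 hp
      exact ⟨by simp, by simp, by simp, by simp⟩
    · rw [hfl, List.flatten_nil, List.append_nil]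
      exact (Finset.nodup_toList _).map Sum.inl_injective
    · simp [hfl]
    · simp [hfl]
  | insert e F he ih =>
    obtain ⟨ps, cs, h⟩ := ih
    obtain ⟨u, v, huv, hu, hv⟩ := hends e
    exact h.exists_insert he huv hu hv (fun e₁ e₂ h1 h2 => hdeg u e₁ e₂ e h1 h2 hu)
      (fun e₁ e₂ h1 h2 => hdeg v e₁ e₂ e h1 h2 hv)

/-! ### Distances along the paths and cycles -/

theorem IsPathList.withinDist_one {p : List (V ⊕ E)} (hp : IsPathList I p) (hnd : p.Nodup) {e : E}
    (hmem : .inr e ∈ p) {u : V} (hu : I u e)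
    (he : ∀ u v w, I u e → I v e → I w e → u = v ∨ u = w ∨ v = w) :
    p.WithinDist 1 (.inl u) (.inr e) := by
  obtain ⟨s, t, rfl⟩ := List.append_of_mem hmem
  rcases List.eq_nil_or_concat s with rfl | ⟨s, x, rfl⟩
  · simpa using hp.head
  cases t with
  | nil => simpa using hp.last
  | cons y t =>
    have hch := hp.chain
    simp only [List.concat_eq_append, List.append_assoc, List.cons_append, List.nil_append]
      at hch hnd ⊢
    have hxy : x ≠ y := by
      rintro rfl
      simp [List.nodup_append] at hnd
    simp only [List.isChain_append_cons_cons, List.isChain_cons_cons] at hch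
    obtain ⟨-, h1, h2, -⟩ := hch
    rcases x with x | x
    swap
    · exact h1.elim
    rcases y with y | y
    swap
    · exact h2.elim
    rcases he u x y hu h1 h2 with rfl | rfl | rfl
    · exact ⟨s.length, s.length + 1, by simp, by simp, by omega, by omega⟩
    · exact ⟨s.length + 2, s.length + 1, by simp, by simp, by omega, by omega⟩
    · exact absurd rfl hxy

theorem IsCycleList.cyclicWithinDist_one {c : List (V ⊕ E)} (hc : IsCycleList I c) (hnd : c.Nodup)
    {e : E} (hmem : .inr e ∈ c) {u : V} (hu : I u e)
    (he : ∀ u v w, I u e → I v e → I w e → u = v ∨ u = w ∨ v = w) :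
    c.CyclicWithinDist 1 (.inl u) (.inr e) := by
  obtain ⟨e₀, p, rfl, hp, hlt, hch⟩ := hc
  rcases List.mem_cons.1 hmem with h | h
  · rw [Sum.inr.injEq] at h
    subst h
    match p, hlt with
    | x :: l, hlt =>
      rcases List.eq_nil_or_concat l with rfl | ⟨l, y, rfl⟩
      · simp at hlt
      simp only [List.concat_eq_append, List.append_assoc, List.cons_append, List.nil_append]
        at hch hnd ⊢
      have hxy : x ≠ y := by
        rintro rfl
        simp at hnd
      rw [List.isChain_cons_cons, ← List.cons_append, List.isChain_append_cons_cons] at hch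
      obtain ⟨h1, -, h2, -⟩ := hch
      rcases x with x | x
      swap
      · exact h1.elim
      rcases y with y | y
      swap
      · exact h2.elim
      rcases he u x y hu h1 h2 with rfl | rfl | rfl
      · exact ⟨1, 0, by simp, by simp, by omega⟩
      · exact ⟨l.length + 2, 0, by simp, by simp, by simp⟩
      · exact absurd rfl hxy
  · obtain ⟨i, j, hi, hj, h1⟩ := hp.withinDist_one (List.nodup_cons.1 hnd).2 h hu he
    exact ⟨i + 1, j + 1, by simpa using hi, by simpa using hj, by omega⟩

/-- `x` and `y` are at distance at most `d` along some path or cycle of the decomposition. -/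
def Near (ps cs : List (List (V ⊕ E))) (d : ℕ) (x y : V ⊕ E) : Prop :=
  (∃ p ∈ ps, p.WithinDist d x y) ∨ ∃ c ∈ cs, c.CyclicWithinDist d x y

theorem Near.symm {d : ℕ} {x y : V ⊕ E} (h : Near ps cs d x y) : Near ps cs d y x := by
  rcases h with ⟨p, hp, i, j, hi, hj, hij⟩ | ⟨c, hc, i, j, hi, hj, hij⟩
  · exact Or.inl ⟨p, hp, j, i, hj, hi, by omega⟩
  · exact Or.inr ⟨c, hc, j, i, hj, hi, by omega⟩

theorem Near.trans (hnd : (ps.flatten ++ cs.flatten).Nodup) {x y z : V ⊕ E}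
    (h : Near ps cs 1 x y) (h' : Near ps cs 1 y z) : Near ps cs 2 x z := by
  obtain ⟨hps, hcs, hdisj⟩ := List.nodup_append'.1 hnd
  rcases h with ⟨p, hp, h⟩ | ⟨p, hp, h⟩ <;> rcases h' with ⟨q, hq, h'⟩ | ⟨q, hq, h'⟩
  · obtain rfl := List.eq_of_mem_of_nodup_flatten hps hp hq h.mem_right h'.mem_left
    have hpnd : p.Nodup := hps.sublist (List.infix_flatten_of_mem hp).sublist
    obtain ⟨i, j, hi, hj, hij⟩ := h
    obtain ⟨j', k, hj', hk, hjk⟩ := h'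
    obtain ⟨hlt, -⟩ := List.getElem?_eq_some_iff.1 hj
    obtain rfl := (List.getElem?_inj hlt hpnd).1 (hj.trans hj'.symm)
    exact Or.inl ⟨p, hp, i, k, hi, hk, by omega⟩
  · exact (hdisj (List.mem_flatten_of_mem hp h.mem_right)
      (List.mem_flatten_of_mem hq h'.mem_left)).elim
  · exact (hdisj (List.mem_flatten_of_mem hq h'.mem_left)
      (List.mem_flatten_of_mem hp h.mem_right)).elim
  · obtain rfl := List.eq_of_mem_of_nodup_flatten hcs hp hq h.mem_right h'.mem_left
    have hpnd : p.Nodup := hcs.sublist (List.infix_flatten_of_mem hp).sublist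
    obtain ⟨i, j, hi, hj, hij⟩ := h
    obtain ⟨j', k, hj', hk, hjk⟩ := h'
    obtain ⟨hlt, -⟩ := List.getElem?_eq_some_iff.1 hj
    obtain ⟨hlti, -⟩ := List.getElem?_eq_some_iff.1 hi
    obtain ⟨hltk, -⟩ := List.getElem?_eq_some_iff.1 hk
    obtain rfl := (List.getElem?_inj hlt hpnd).1 (hj.trans hj'.symm)
    exact Or.inr ⟨p, hp, i, k, hi, hk, by omega⟩

theorem IsDecomposition.near_one (h : IsDecomposition I F ps cs)
    (hends : ∀ e u v w, I u e → I v e → I w e → u = v ∨ u = w ∨ v = w) (hF : ∀ e, e ∈ F)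
    {x y : V ⊕ E} (hxy : Consec I x y) : Near ps cs 1 x y := by
  have key : ∀ u e, I u e → Near ps cs 1 (.inl u) (.inr e) := by
    intro u e hu
    obtain ⟨hps, hcs, -⟩ := List.nodup_append'.1 h.nodup
    rcases List.mem_append.1 ((h.edge_mem_iff e).2 (hF e)) with hm | hm
    · obtain ⟨p, hp, hep⟩ := List.mem_flatten.1 hm
      exact Or.inl ⟨p, hp, (h.path p hp).withinDist_one
        (hps.sublist (List.infix_flatten_of_mem hp).sublist) hep hu (hends e)⟩
    · obtain ⟨c, hc, hec⟩ := List.mem_flatten.1 hm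
      exact Or.inr ⟨c, hc, (h.cycle c hc).cyclicWithinDist_one
        (hcs.sublist (List.infix_flatten_of_mem hc).sublist) hec hu (hends e)⟩
  rcases x with u | e <;> rcases y with v | f
  · exact hxy.elim
  · exact key u f hxy
  · exact (key v e hxy).symm
  · exact hxy.elim

end IncidenceList

end

/-! ### Total graphs of multigraphs of maximum degree at most two -/

namespace Graph

open IncidenceList

variable {α β : Type*} {G : Graph α β}

theorem ncard_incidenceSet_le (hV : G.vertexSet.Finite) (v : G.vertexSet) :
    (G.incidenceSet v).ncard ≤ G.maxDegree := by
  have := hV.to_subtype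
  exact le_ciSup (f := fun v : G.vertexSet => G.degree v) (Set.finite_range _).bddAbove v

/-- Adjacency in the total graph is distance at most two in the subdivision. -/
theorem totalGraph_adj {x y : G.vertexSet ⊕ G.edgeSet} (h : G.totalGraph.Adj x y) :
    Consec (fun (v : G.vertexSet) (e : G.edgeSet) => G.Inc e v) x y ∨
      ∃ z, Consec (fun (v : G.vertexSet) (e : G.edgeSet) => G.Inc e v) x z ∧
        Consec (fun (v : G.vertexSet) (e : G.edgeSet) => G.Inc e v) z y := by
  rcases x with u | e <;> rcases y with v | f
  · obtain ⟨-, e, he⟩ := h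
    exact Or.inr ⟨.inr ⟨e, he.edge_mem⟩, he.inc_left, he.inc_right⟩
  · exact Or.inl h
  · exact Or.inl h
  · obtain ⟨-, w, h1, h2⟩ := h
    exact Or.inr ⟨.inl ⟨w, h1.vertex_mem⟩, h1, h2⟩

theorem totalGraph_equitablyChoosable (hV : G.vertexSet.Finite) (hE : G.edgeSet.Finite)
    (hG : G.Loopless) (hΔ : G.maxDegree ≤ 2) {k : ℕ} (hk : G.maxDegree + 2 ≤ k) :
    G.totalGraph.EquitablyChoosable k := by
  classical
  have := hV.to_subtype
  have := hE.to_subtype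
  have := Fintype.ofFinite G.edgeSet
  let I : G.vertexSet → G.edgeSet → Prop := fun v e => G.Inc e v
  have hfin : ∀ v : G.vertexSet, (G.incidenceSet v).Finite :=
    fun v => hE.subset (G.incidenceSet_subset_edgeSet v)
  have hends : ∀ e, ∃ u v, u ≠ v ∧ I u e ∧ I v e := by
    intro e
    obtain ⟨x, y, hxy⟩ := G.exists_isLink_of_mem_edgeSet e.2
    exact ⟨⟨x, hxy.left_mem⟩, ⟨y, hxy.right_mem⟩, fun h => hxy.ne (Subtype.ext_iff.1 h),
      hxy.inc_left, hxy.inc_right⟩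
  have hends' : ∀ e u v w, I u e → I v e → I w e → u = v ∨ u = w ∨ v = w := by
    intro e u v w hu hv hw
    simpa only [Subtype.ext_iff] using hu.eq_or_eq_or_eq hv hw
  have hdeg2 : ∀ v e₁ e₂, I v e₁ → I v e₂ → e₁ ≠ e₂ → 2 ≤ G.maxDegree := by
    intro v e₁ e₂ h1 h2 h12
    refine le_trans ?_ (ncard_incidenceSet_le hV v)
    rw [← Set.ncard_pair (Subtype.coe_ne_coe.2 h12)]
    refine Set.ncard_le_ncard ?_ (hfin v)
    rintro x (rfl | rfl)
    exacts [h1, h2]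
  have hdeg : ∀ v e₁ e₂ e₃, I v e₁ → I v e₂ → I v e₃ → e₁ = e₂ ∨ e₁ = e₃ ∨ e₂ = e₃ := by
    intro v e₁ e₂ e₃ h1 h2 h3
    by_contra! hne
    have hsub : ({(e₁ : β), (e₂ : β), (e₃ : β)} : Set β) ⊆ G.incidenceSet v := by
      rintro x (rfl | rfl | rfl)
      exacts [h1, h2, h3]
    have hle := Set.ncard_le_ncard hsub (hfin v)
    rw [Set.ncard_eq_three.2 ⟨_, _, _, Subtype.coe_ne_coe.2 hne.1, Subtype.coe_ne_coe.2 hne.2.1,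
      Subtype.coe_ne_coe.2 hne.2.2, rfl⟩] at hle
    have := ncard_incidenceSet_le hV v
    omega
  obtain ⟨ps, cs, h⟩ := exists_isDecomposition hends hdeg Finset.univ
  have hmem : ∀ x, x ∈ ps.flatten ++ cs.flatten := by
    rintro (v | e)
    · exact h.vertex_mem v
    · exact (h.edge_mem_iff e).2 (Finset.mem_univ e)
  have hnear : ∀ {x y}, Consec I x y → Near ps cs 1 x y :=
    fun hxy => h.near_one hends' Finset.mem_univ hxy
  have hadj : ∀ x y, G.totalGraph.Adj x y → Near ps cs 2 x y := by
    intro x y hxy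
    rcases totalGraph_adj hxy with hc | ⟨z, h1, h2⟩
    · rcases hnear hc with ⟨p, hp, i, j, hi, hj, hij⟩ | ⟨c, hc, i, j, hi, hj, hij⟩
      · exact Or.inl ⟨p, hp, i, j, hi, hj, by omega⟩
      · exact Or.inr ⟨c, hc, i, j, hi, hj, by omega⟩
    · exact (hnear h1).trans h.nodup (hnear h2)
  rcases (by omega : k = 4 ∨ 5 ≤ k ∨ G.maxDegree ≤ 1) with rfl | hk5 | hΔ1
  · refine SimpleGraph.equitablyChoosable_four h.nodup hmem
      (fun c hc => (h.cycle c hc).even_length) fun x y hxy => ?_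
    rcases hadj x y hxy with ⟨p, hp, hpxy⟩ | hc
    · exact Or.inl (hpxy.of_infix (List.infix_flatten_of_mem hp))
    · exact Or.inr hc
  · -- zigzagging each cycle gives a linear order of bandwidth four
    have hperm : ((cs.map List.zigzag).flatten).Perm cs.flatten :=
      List.Perm.flatten_congr (by
        rw [List.forall₂_map_left_iff]
        exact List.forall₂_same.2 fun c _ => c.zigzag_perm)
    have hperm' := hperm.append_left ps.flatten
    refine SimpleGraph.equitablyChoosable_of_withinDist (by omega) (hperm'.nodup_iff.2 h.nodup)
      (fun x => hperm'.mem_iff.2 (hmem x)) fun x y hxy => ?_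
    rcases hadj x y hxy with ⟨p, hp, hpxy⟩ | ⟨c, hc, hcxy⟩
    · exact (hpxy.of_infix ((List.infix_flatten_of_mem hp).trans
        (List.prefix_append _ _).isInfix)).mono (by omega)
    · exact (hcxy.zigzag.of_infix ((List.infix_flatten_of_mem (List.mem_map_of_mem hc)).trans
        (List.suffix_append _ _).isInfix)).mono (by omega)
  · have hcs : cs = [] := by
      refine List.eq_nil_iff_forall_not_mem.2 fun c hc => ?_
      obtain ⟨u, e₁, e₂, hne, h1, h2⟩ := (h.cycle c hc).exists_edges
        ((List.nodup_append'.1 h.nodup).2.1.sublist (List.infix_flatten_of_mem hc).sublist)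
      have := hdeg2 u e₁ e₂ h1 h2 hne
      omega
    subst hcs
    simp only [List.flatten_nil, List.append_nil] at hmem
    have hnd : ps.flatten.Nodup := by simpa using h.nodup
    refine SimpleGraph.equitablyChoosable_of_withinDist (by omega) hnd hmem fun x y hxy => ?_
    have hpos : 1 ≤ G.maxDegree := by
      have hinc : ∃ v e, I v e := by
        have key : ∀ {x y}, Consec I x y → ∃ v e, I v e := by
          rintro (u | e) (v | f) hc
          exacts [hc.elim, ⟨u, f, hc⟩, ⟨v, e, hc⟩, hc.elim]
        rcases totalGraph_adj hxy with hc | ⟨z, hc, -⟩ <;> exact key hc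
      obtain ⟨v, e, hve⟩ := hinc
      refine le_trans ?_ (ncard_incidenceSet_le hV v)
      exact (Set.ncard_pos (hfin v)).2 ⟨e, hve⟩
    rcases hadj x y hxy with ⟨p, hp, hpxy⟩ | ⟨c, hc, -⟩
    · exact (hpxy.of_infix (List.infix_flatten_of_mem hp)).mono (by omega)
    · simp at hc

end Graph

theorem theorem3 {α β : Type*} (G : Graph α β) (hV : G.vertexSet.Finite) (hE : G.edgeSet.Finite)
    (hG : G.Loopless) (hΔ : G.maxDegree ≤ 2) :
    (∀ k : ℕ, G.maxDegree + 2 ≤ k → G.totalGraph.EquitablyChoosable k) ∧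
      (G.Simple → G.ListEquitableTotalColoring) :=
  ⟨fun _ hk => G.totalGraph_equitablyChoosable hV hE hG hΔ hk,
    fun _ _ hk => G.totalGraph_equitablyChoosable hV hE hG hΔ ((le_max_right _ _).trans hk)⟩
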